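/- Let $k,m,n$ be positive integers with $km>n$, let $a,c\in\mathbb Z$, and let $f(x)=(x^k+c)^m-ax^n\in\mathbb Z[x]$ be irreducible over $\mathbb Q$, with discriminant $\mathfrak D_f$. Let $\mathscr E_f$ be the set of primes $p\mid\mathfrak D_f$ such that either $p\nmid cakm$, or $m=1$, $p\mid c$ and $p\nmid a(k-n)$. Let $g(x)\in\mathbb Z[x]$ have degree $d$, leading coefficient $\pm1$ and discriminant $\mathfrak D_g$, and suppose that $T(x)=f(g(x))$ is irreducible over $\mathbb Q$. Let $K=\mathbb Q(\theta)$, where $\theta$ is a root of $T(x)$, and let $\mathbb Z_K$ be the ring of integers of $K$. Assume that the product $\operatorname{rad}(k)$ of the distinct primes dividing $k$ divides $ca$, and that for every $p\in\mathscr E_f$ one has $p\mid g(0)$, $p\nmid d$ and $g'(x)\equiv dx^{d-1}\pmod p$. If $n=1$, assume moreover that $p\nmid\mathfrak D_g$ for every prime $p$ with $p\mid\mathfrak D_f$, $p\mid c$ and $p\nmid a$. Then the following are equivalent: 1. no prime dividing $\mathfrak D_f$ divides the index $[\mathbb Z_K:\mathbb Z[\theta]]$; 2. $f(x)$ is monogenic,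 that is, $\mathbb Z[\vartheta]$ is the ring of integers of $\mathbb Q(\vartheta)$ for a root $\vartheta$ of $f(x)$. -/

import Mathlib

open Polynomial

/-- The polynomial `(x ^ k + c) ^ m - a * x ^ n` over `ℤ`. -/
noncomputable def familyPoly (a c : ℤ) (k m n : ℕ) : ℤ[X] :=
  (X ^ k + C c) ^ m - C a * X ^ n

/-- The set of exceptional primes attached to `f = (x ^ k + c) ^ m - a * x ^ n`: the primes `p`
dividing the discriminant of `f` with `p ∤ c a k m`, together with (when `m = 1`) the primes `p`
dividing the discriminant of `f` with `p ∣ c` and `p ∤ a (k - n)`. -/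
def exceptionalPrimes (a c : ℤ) (k m n : ℕ) : Set ℕ :=
  {p | p.Prime ∧ (p : ℤ) ∣ (familyPoly a c k m n).discr ∧ ¬ (p : ℤ) ∣ c * a * k * m} ∪
  {p | p.Prime ∧ (p : ℤ) ∣ (familyPoly a c k m n).discr ∧ m = 1 ∧ (p : ℤ) ∣ c ∧
    ¬ (p : ℤ) ∣ a * ((k : ℤ) - n)}

/-- The index `[ℤ_K : ℤ[θ]]`, for `θ` an algebraic integer of `K`: the index of the additive group
of `ℤ[θ]` in the additive group of the integral closure `ℤ_K` of `ℤ` in `K`. -/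
noncomputable def integralIndex (K : Type*) [Field K] (θ : K) : ℕ :=
  (Subalgebra.toSubmodule (Algebra.adjoin ℤ {θ})).toAddSubgroup.relIndex
    (Subalgebra.toSubmodule (integralClosure ℤ K)).toAddSubgroup

/-- A polynomial `f` over `ℤ` is monogenic if it is monic, irreducible over `ℚ`, and
`ℤ[ϑ] = ℤ_L` for the root `ϑ` of `f` in the field `L = ℚ[x]/(f)`. -/
def IsMonogenicPoly (f : ℤ[X]) : Prop :=
  f.Monic ∧ Irreducible (f.map (Int.castRingHom ℚ)) ∧
    Algebra.adjoin ℤ {AdjoinRoot.root (f.map (Int.castRingHom ℚ))} =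
      integralClosure ℤ (AdjoinRoot (f.map (Int.castRingHom ℚ)))

/-! The index is controlled by regularity of `ℤ[X]/(T)` at its closed points. For `β` algebraic over
`𝔽_p`, let `m_β` be the maximal ideal of integer polynomials vanishing at `β`. Then `p` divides the
index of `ℤ[θ]` exactly when `T ∈ m_β ^ 2` for some `β`, a form of Dedekind's criterion
(`exists_integral_notMem_adjoin_of_mem_sq`, `mem_adjoin_of_natCast_mul_mem`).

Composition with `g` carries `m_{g(β)} ^ 2` into `m_β ^ 2`, and `g` is surjective on an algebraic
closure of `𝔽_p`. So a singular point of `f` gives one of `f ∘ g`; it is a multiple root of `f` mod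
`p`, hence `p ∣ 𝔇_f`.

Conversely, let `f` be regular and `f ∘ g ∈ m_β ^ 2`. A multiple root `g(β)` of `f` is impossible:
there `f ≡ p H` modulo the square with `H(g(β)) ≠ 0`, and this survives composition
(`comp_notMem_sq`). At a simple root the chain rule gives `g'(β) = 0`. The arithmetic hypotheses
then leave only `n = 1`, `p ∣ c`, `p ∤ a`, `g(β) = 0`, so `β` is a multiple root of `g` and `p ∣
𝔇_g`, which is excluded. -/

theorem mem_span_pair_sq {R : Type*} [CommRing R] {x y z : R} :
    z ∈ Ideal.span {x, y} ^ 2 ↔ ∃ A B D, z = x ^ 2 * A + x * y * B + y ^ 2 * D := by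
  rw [pow_two, Ideal.span_pair_mul_span_pair]
  constructor
  · intro h
    simp only [Ideal.mem_span_insert, Ideal.mem_span_singleton'] at h
    obtain ⟨a, _, ⟨b, _, ⟨c, _, ⟨d, rfl⟩, rfl⟩, rfl⟩, rfl⟩ := h
    exact ⟨a, b + c, d, by ring⟩
  · rintro ⟨A, B, D, rfl⟩
    refine add_mem (add_mem ?_ ?_) ?_
    · exact pow_two x ▸ Ideal.mul_mem_right _ _ (Ideal.subset_span (by simp))
    · exact Ideal.mul_mem_right _ _ (Ideal.subset_span (by simp))
    · exact pow_two y ▸ Ideal.mul_mem_right _ _ (Ideal.subset_span (by simp))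

/-! ### Closed points of the affine line over `ℤ` and squares of their ideals. -/

section Residue

variable {F : Type*} [Field F]

/-- The ideal of integer polynomials vanishing at the point `β` of a field `F`. -/
noncomputable def vanishingIdealAt (β : F) : Ideal ℤ[X] :=
  RingHom.ker (aeval β : ℤ[X] →ₐ[ℤ] F)

theorem mem_vanishingIdealAt {β : F} {P : ℤ[X]} : P ∈ vanishingIdealAt β ↔ aeval β P = 0 :=
  Iff.rfl

theorem comp_mem_vanishingIdealAt_sq {β : F} {P : ℤ[X]} (G : ℤ[X])
    (hP : P ∈ vanishingIdealAt (aeval β G) ^ 2) : P.comp G ∈ vanishingIdealAt β ^ 2 := by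
  have h := Ideal.mem_map_of_mem (compRingHom G) hP
  rw [Ideal.map_pow] at h
  refine Ideal.pow_right_mono (Ideal.map_le_iff_le_comap.2 fun Q hQ => ?_) 2 h
  simpa [mem_vanishingIdealAt, aeval_comp] using hQ

theorem C_dvd_of_map_eq_zero {p : ℕ} {P : ℤ[X]} (h : P.map (Int.castRingHom (ZMod p)) = 0) :
    C (p : ℤ) ∣ P := by
  rw [C_dvd_iff_dvd_coeff]
  intro i
  have := congrArg (fun Q => coeff Q i) h
  simpa [ZMod.intCast_zmod_eq_zero_iff_dvd] using this

theorem exists_map_eq (p : ℕ) (Q : (ZMod p)[X]) :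
    ∃ P : ℤ[X], P.map (Int.castRingHom (ZMod p)) = Q :=
  map_surjective _ ZMod.intCast_surjective Q

variable {p : ℕ} [Fact p.Prime] [Algebra (ZMod p) F]

theorem aeval_map_zmod (β : F) (P : ℤ[X]) :
    aeval β (P.map (Int.castRingHom (ZMod p))) = aeval β P := by
  rw [aeval_def, eval₂_map, aeval_def]
  congr 1
  exact RingHom.ext_int _ _

theorem natCast_eq_zero_of_algebra : ((p : ℕ) : F) = 0 := by
  have : ((p : ℕ) : ZMod p) = 0 := by simp
  rw [← map_natCast (algebraMap (ZMod p) F), this, map_zero]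

/-- The residue ideal is generated by `p` and a lift of the minimal polynomial, and the lift is
unramified at the point. -/
theorem exists_vanishingIdealAt_eq_span [Algebra.IsAlgebraic (ZMod p) F] (β : F) :
    ∃ ψ : ℤ[X], vanishingIdealAt β = Ideal.span {C (p : ℤ), ψ} ∧
      aeval β (derivative ψ) ≠ 0 := by
  have hint : IsIntegral (ZMod p) β := Algebra.IsIntegral.isIntegral β
  obtain ⟨ψ, hψ⟩ := exists_map_eq p (minpoly (ZMod p) β)
  refine ⟨ψ, le_antisymm (fun P hP => ?_) ?_, ?_⟩
  · rw [mem_vanishingIdealAt, ← aeval_map_zmod (p := p)] at hP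
    obtain ⟨Q, hQ⟩ := minpoly.dvd _ _ hP
    obtain ⟨Q, rfl⟩ := exists_map_eq p Q
    rw [← hψ, ← Polynomial.map_mul, ← sub_eq_zero, ← Polynomial.map_sub] at hQ
    obtain ⟨R, hR⟩ := C_dvd_of_map_eq_zero hQ
    rw [Ideal.mem_span_pair]
    exact ⟨R, Q, by linear_combination -hR⟩
  · rw [Ideal.span_le]
    rintro P (rfl | rfl)
    · simp [mem_vanishingIdealAt, natCast_eq_zero_of_algebra (p := p) (F := F)]
    · simp [mem_vanishingIdealAt, ← aeval_map_zmod (p := p), hψ]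
  · have hsep := (PerfectField.separable_of_irreducible (minpoly.irreducible hint))
    have := hsep.aeval_derivative_ne_zero (minpoly.aeval _ β)
    rwa [← hψ, derivative_map, aeval_map_zmod] at this

variable [Algebra.IsAlgebraic (ZMod p) F]

theorem aeval_derivative_eq_zero_of_mem_sq (p : ℕ) [Fact p.Prime] [Algebra (ZMod p) F]
    [Algebra.IsAlgebraic (ZMod p) F] {β : F} {P : ℤ[X]}
    (hP : P ∈ vanishingIdealAt β ^ 2) : aeval β (derivative P) = 0 := by
  obtain ⟨ψ, hψ, -⟩ := exists_vanishingIdealAt_eq_span (p := p) β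
  have hψ0 : aeval β ψ = 0 := by
    rw [← mem_vanishingIdealAt, hψ]
    exact Ideal.subset_span (by simp)
  rw [hψ] at hP
  obtain ⟨A, B, D, rfl⟩ := mem_span_pair_sq.1 hP
  simp [derivative_pow, natCast_eq_zero_of_algebra (p := p) (F := F), hψ0]

/-- A polynomial with a multiple root at `β` is congruent to a multiple of `p` modulo the square of
the residue ideal. -/
theorem exists_sub_C_mul_mem_sq {β : F} {P : ℤ[X]} (hP : aeval β P = 0)
    (hP' : aeval β (derivative P) = 0) :
    ∃ H, P - C (p : ℤ) * H ∈ vanishingIdealAt β ^ 2 := by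
  obtain ⟨ψ, hψ, hd⟩ := exists_vanishingIdealAt_eq_span (p := p) β
  have hψm : ψ ∈ vanishingIdealAt β := by
    rw [hψ]
    exact Ideal.subset_span (by simp)
  rw [← mem_vanishingIdealAt, hψ, Ideal.mem_span_pair] at hP
  obtain ⟨A, B, rfl⟩ := hP
  have hB : B ∈ vanishingIdealAt β := by
    rw [mem_vanishingIdealAt] at hψm ⊢
    simpa [natCast_eq_zero_of_algebra (p := p) (F := F), hψm, hd] using hP'
  refine ⟨A, ?_⟩
  rw [show A * C (p : ℤ) + B * ψ - C (p : ℤ) * A = B * ψ by ring, pow_two]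
  exact Ideal.mul_mem_mul hB hψm

/-- The generators `p`, `ψ` form a regular system of parameters, so `p` is nonzero in the cotangent
space. -/
theorem mem_of_C_mul_mem_sq {β : F} {H : ℤ[X]}
    (hH : C (p : ℤ) * H ∈ vanishingIdealAt β ^ 2) : H ∈ vanishingIdealAt β := by
  obtain ⟨ψ, hψ, hd⟩ := exists_vanishingIdealAt_eq_span (p := p) β
  have hp0 : C (p : ℤ) ≠ 0 := by simpa using (Fact.out : p.Prime).ne_zero
  have hpr : Prime (C (p : ℤ)) :=
    prime_C_iff.2 (Nat.prime_iff_prime_int.1 (Fact.out : p.Prime))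
  rw [hψ] at hH ⊢
  obtain ⟨A, B, D, h⟩ := mem_span_pair_sq.1 hH
  have hdvd : C (p : ℤ) ∣ ψ ^ 2 * D := ⟨H - C (p : ℤ) * A - ψ * B, by linear_combination -h⟩
  rcases hpr.dvd_or_dvd hdvd with h1 | ⟨E, rfl⟩
  · obtain ⟨E, rfl⟩ := hpr.dvd_of_dvd_pow h1
    simp [natCast_eq_zero_of_algebra (p := p) (F := F)] at hd
  · rw [Ideal.mem_span_pair]
    refine ⟨A, B + ψ * E, mul_left_cancel₀ hp0 ?_⟩
    linear_combination -h

/-- If `P` is regular at the multiple root `g(β)`, then `P ∘ g` is regular at `β`. -/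
theorem comp_notMem_sq (p : ℕ) [Fact p.Prime] [Algebra (ZMod p) F]
    [Algebra.IsAlgebraic (ZMod p) F] {β : F} {P G : ℤ[X]} (h0 : aeval (aeval β G) P = 0)
    (h1 : aeval (aeval β G) (derivative P) = 0)
    (hP : P ∉ vanishingIdealAt (aeval β G) ^ 2) : P.comp G ∉ vanishingIdealAt β ^ 2 := by
  intro hT
  obtain ⟨H, hH⟩ := exists_sub_C_mul_mem_sq (p := p) h0 h1
  have h2 := comp_mem_vanishingIdealAt_sq G hH
  have h3 : C (p : ℤ) * H.comp G ∈ vanishingIdealAt β ^ 2 := by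
    have := sub_mem hT h2
    simpa using this
  have h4 : H ∈ vanishingIdealAt (aeval β G) := by
    simpa [mem_vanishingIdealAt, aeval_comp] using mem_of_C_mul_mem_sq h3
  refine hP ?_
  obtain ⟨ψ, hψ, hd⟩ := exists_vanishingIdealAt_eq_span (p := p) (aeval β G)
  have h5 : C (p : ℤ) ∈ vanishingIdealAt (aeval β G) := by
    rw [hψ]
    exact Ideal.subset_span (by simp)
  have := add_mem hH (pow_two (vanishingIdealAt (aeval β G)) ▸ Ideal.mul_mem_mul h5 h4)
  simpa using this

end Residue

/-! ### Discriminants and multiple roots after reduction. -/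

section Discriminant

variable {F : Type*} [Field F] [IsAlgClosed F]

/-- A unit leading coefficient keeps the degree under reduction, so the resultant of `P` and `P'`
reduces to a unit times the product of the values of `P'` at the roots. -/
theorem intCast_discr_eq_zero_iff {P : ℤ[X]} (hP : IsUnit P.leadingCoeff)
    (hdeg : 0 < P.natDegree) :
    (P.discr : F) = 0 ↔ ∃ α : F, aeval α P = 0 ∧ aeval α (derivative P) = 0 := by
  set φ := Int.castRingHom F
  have hu : IsUnit (φ P.leadingCoeff) := hP.map φ
  have hnd : (P.map φ).natDegree = P.natDegree :=
    natDegree_map_of_leadingCoeff_ne_zero _ hu.ne_zero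
  have h1 := congrArg φ (resultant_deriv (natDegree_pos_iff_degree_pos.1 hdeg))
  rw [← resultant_map_map, ← derivative_map] at h1
  have h2 := resultant_eq_prod_eval (P.map φ) (derivative (P.map φ)) (P.natDegree - 1)
    (hnd ▸ natDegree_derivative_le _) (IsAlgClosed.splits _)
  rw [hnd, h1] at h2
  have hlc : (P.map φ).leadingCoeff ≠ 0 := by
    rw [leadingCoeff_map_of_leadingCoeff_ne_zero _ hu.ne_zero]
    exact hu.ne_zero
  have hae : ∀ (α : F) (Q : ℤ[X]), eval α (Q.map φ) = aeval α Q := fun α Q => by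
    rw [eval_map, aeval_def]
    rfl
  have h3 : (P.discr : F) = 0 ↔ ((P.map φ).roots.map (derivative (P.map φ)).eval).prod = 0 := by
    have hlc' : (P.leadingCoeff : F) ≠ 0 := hu.ne_zero
    have := congrArg (· = 0) h2
    simpa [hlc', hlc, φ] using this
  rw [h3, Multiset.prod_eq_zero_iff, Multiset.mem_map]
  have hne : P.map φ ≠ 0 := leadingCoeff_ne_zero.1 hlc
  simp only [mem_roots hne, IsRoot.def, derivative_map, hae]

end Discriminant

/-! ### Regularity of `ℤ[X]/(T)` and the index of `ℤ[θ]`. -/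

section IntegralClosure

variable {K : Type*} [Field K] {θ : K} {T : ℤ[X]}

theorem isUnit_intCast_of_isUnit {u : ℤ} (hu : IsUnit u) {R : Type*} [Ring R] : IsUnit (u : R) := by
  rcases Int.isUnit_iff.1 hu with rfl | rfl <;> simp

theorem isIntegral_of_isUnit_leadingCoeff (hT : IsUnit T.leadingCoeff) (h : aeval θ T = 0) :
    IsIntegral ℤ θ := by
  refine ⟨C T.leadingCoeff * T, ?_, ?_⟩
  · rw [Monic, leadingCoeff_mul, leadingCoeff_C]
    exact Int.isUnit_mul_self hT
  · rw [← aeval_def, map_mul, h, mul_zero]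

theorem mem_adjoin_iff_exists_aeval {y : K} :
    y ∈ Algebra.adjoin ℤ {θ} ↔ ∃ P : ℤ[X], aeval θ P = y := by
  rw [Algebra.adjoin_singleton_eq_range_aeval]
  rfl

theorem aeval_eq_zero_iff_dvd [CharZero K] (hT : IsUnit T.leadingCoeff)
    (hirr : Irreducible (T.map (Int.castRingHom ℚ))) (h : aeval θ T = 0) {P : ℤ[X]} :
    aeval θ P = 0 ↔ T ∣ P := by
  constructor
  · intro hP
    have hprim : T.IsPrimitive := fun r hr => isUnit_of_dvd_unit (C_dvd_iff_dvd_coeff _ _ |>.1 hr _) hT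
    have hmap : ∀ Q : ℤ[X], aeval θ (Q.map (Int.castRingHom ℚ)) = aeval θ Q := fun Q => by
      rw [← algebraMap_int_eq, aeval_map_algebraMap]
    have hd : T.map (Int.castRingHom ℚ) ∣ P.map (Int.castRingHom ℚ) := by
      refine (Dvd.intro _ (minpoly.eq_of_irreducible hirr ((hmap T).trans h))).trans ?_
      exact minpoly.dvd _ _ ((hmap P).trans hP)
    exact (IsPrimitive.Int.dvd_iff_map_cast_dvd_map_cast _ _ hprim).2 hd
  · rintro ⟨Q, rfl⟩
    rw [map_mul, h, zero_mul]

theorem exists_integral_notMem_adjoin_of_mem_sq [CharZero K] (hT : IsUnit T.leadingCoeff)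
    (hirr : Irreducible (T.map (Int.castRingHom ℚ))) (h : aeval θ T = 0)
    {F : Type*} [Field F] (p : ℕ) [Fact p.Prime] [Algebra (ZMod p) F]
    [Algebra.IsAlgebraic (ZMod p) F] {β : F} (hβ : T ∈ vanishingIdealAt β ^ 2) :
    ∃ y : K, IsIntegral ℤ y ∧ (p : K) * y ∈ Algebra.adjoin ℤ {θ} ∧
      y ∉ Algebra.adjoin ℤ {θ} := by
  obtain ⟨ψ, hψ, -⟩ := exists_vanishingIdealAt_eq_span (p := p) β
  have hψ0 : aeval β ψ = 0 := by
    rw [← mem_vanishingIdealAt, hψ]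
    exact Ideal.subset_span (by simp)
  have hp : (p : K) ≠ 0 := by exact_mod_cast (Fact.out : p.Prime).ne_zero
  rw [hψ] at hβ
  obtain ⟨A, B, D, hABD⟩ := mem_span_pair_sq.1 hβ
  have hrel : (p : K) ^ 2 * aeval θ A + p * aeval θ ψ * aeval θ B
      + aeval θ ψ ^ 2 * aeval θ D = 0 := by
    rw [hABD] at h
    simpa using h
  -- Multiplying `T(θ) = 0` by `D(θ) / p ^ 2` shows that this element is a root of `Y ^ 2 + B(θ) Y +
  -- A(θ) D(θ)`.
  refine ⟨aeval θ ψ * aeval θ D / p, ?_, ?_, ?_⟩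
  · have hθ := isIntegral_of_isUnit_leadingCoeff hT h
    have hle : Algebra.adjoin ℤ {θ} ≤ integralClosure ℤ K := by
      rw [Algebra.adjoin_le_iff, Set.singleton_subset_iff]
      exact hθ
    let S := integralClosure ℤ K
    have hS : ∀ P : ℤ[X], aeval θ P ∈ S := fun P => hle (mem_adjoin_iff_exists_aeval.2 ⟨P, rfl⟩)
    let b : S := ⟨aeval θ B, hS B⟩
    let e : S := ⟨aeval θ D * aeval θ A, S.mul_mem (hS D) (hS A)⟩
    refine isIntegral_trans (R := ℤ) (A := S) _ ⟨X ^ 2 + C b * X + C e, ?_, ?_⟩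
    · monicity!
    · have hb : algebraMap S K b = aeval θ B := rfl
      have he : algebraMap S K e = aeval θ D * aeval θ A := rfl
      simp only [eval₂_add, eval₂_pow, eval₂_X, eval₂_mul, eval₂_C, hb, he]
      field_simp
      linear_combination (aeval θ D) * hrel
  · rw [mul_div_cancel₀ _ hp]
    exact mem_adjoin_iff_exists_aeval.2 ⟨ψ * D, map_mul _ _ _⟩
  -- Otherwise `T` divides `ψ D - p E`; as `T ≡ ψ ^ 2 D` mod `p`, cancelling `ψ D` makes `ψ` a unit
  -- mod `p`, yet `ψ(β) = 0`.
  · intro hy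
    obtain ⟨E, hE⟩ := mem_adjoin_iff_exists_aeval.1 hy
    have h1 : aeval θ (ψ * D - C (p : ℤ) * E) = 0 := by
      simp [hE, mul_div_cancel₀ _ hp]
    obtain ⟨Q, hQ⟩ := (aeval_eq_zero_iff_dvd hT hirr h).1 h1
    set φ := mapRingHom (Int.castRingHom (ZMod p)) with hφ
    have hp0 : φ (C (p : ℤ)) = 0 := by simp [hφ]
    have hT1 : φ T = φ ψ * (φ ψ * φ D) := by
      rw [hABD]
      simp only [map_add, map_mul, map_pow, hp0]
      ring
    have hT0 : φ T ≠ 0 := fun h0 => by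
      have := congrArg (coeff · T.natDegree) h0
      simp only [hφ, coe_mapRingHom, coeff_map, coeff_zero] at this
      exact (isUnit_intCast_of_isUnit hT (R := ZMod p)).ne_zero this
    have h2 : φ ψ * φ D = φ ψ * φ D * (φ ψ * φ Q) := by
      have := congrArg φ hQ
      rw [map_sub, map_mul, map_mul, map_mul, hp0, hT1] at this
      linear_combination this
    have h3 : φ ψ * φ Q = 1 := by
      have hne : φ ψ * φ D ≠ 0 := right_ne_zero_of_mul (hT1 ▸ hT0)
      exact (mul_left_cancel₀ hne (by rw [mul_one]; exact h2)).symm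
    rw [← map_mul] at h3
    have h4 := congrArg (aeval β) h3
    rw [hφ, coe_mapRingHom, aeval_map_zmod, map_mul, hψ0, map_one, zero_mul] at h4
    exact zero_ne_one h4

/-- If `T` is regular at every point of residue characteristic `p`, then `ℤ[θ]` is maximal
at `p`. -/
theorem mem_adjoin_of_natCast_mul_mem (hθ : IsIntegral ℤ θ) (hT : aeval θ T = 0)
    (F : Type*) [Field F] [IsAlgClosed F] (p : ℕ) [Fact p.Prime] [Algebra (ZMod p) F]
    (hp0 : (p : K) ≠ 0) (hreg : ∀ β : F, T ∉ vanishingIdealAt β ^ 2)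
    {y : K} (hy : IsIntegral ℤ y) (hpy : (p : K) * y ∈ Algebra.adjoin ℤ {θ}) :
    y ∈ Algebra.adjoin ℤ {θ} := by
  by_contra hyn
  let cond : K → Ideal ℤ[X] := fun z =>
    { carrier := {P | aeval θ P * z ∈ Algebra.adjoin ℤ {θ}}
      add_mem' := fun {a b} ha hb => by
        simp only [Set.mem_ofPred_eq, map_add, add_mul] at *
        exact add_mem ha hb
      zero_mem' := by simp
      smul_mem' := fun c x hx => by
        simp only [Set.mem_ofPred_eq, smul_eq_mul, map_mul, mul_assoc] at *
        exact mul_mem (mem_adjoin_iff_exists_aeval.2 ⟨c, rfl⟩) hx }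
  have hcond : ∀ z P, P ∈ cond z ↔ aeval θ P * z ∈ Algebra.adjoin ℤ {θ} := fun _ _ => Iff.rfl
  have hC : aeval θ (C (p : ℤ)) = (p : K) := by simp
  -- A counterexample `z` with maximal denominator ideal: maximality makes that ideal prime.
  obtain ⟨M, ⟨z, hz, hpz, hzn, rfl⟩, hmax⟩ := set_has_maximal_iff_noetherian.2
    (inferInstance : IsNoetherian ℤ[X] ℤ[X])
    {I | ∃ z, IsIntegral ℤ z ∧ (p : K) * z ∈ Algebra.adjoin ℤ {θ} ∧
      z ∉ Algebra.adjoin ℤ {θ} ∧ I = cond z} ⟨_, y, hy, hpy, hyn, rfl⟩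
  have hadj : ∀ P : ℤ[X], aeval θ P ∈ Algebra.adjoin ℤ {θ} := fun P =>
    mem_adjoin_iff_exists_aeval.2 ⟨P, rfl⟩
  have hint : ∀ P : ℤ[X], IsIntegral ℤ (aeval θ P) := fun P =>
    adjoin_le_integralClosure hθ (hadj P)
  have hzero : ∀ P, aeval θ P = 0 → P ∈ cond z := fun P hP => by simp [hcond, hP]
  have hone : (1 : ℤ[X]) ∉ cond z := by simpa [hcond] using hzn
  have hpM : C (p : ℤ) ∈ cond z := by rwa [hcond, hC]
  have hprime : ∀ a b, a * b ∈ cond z → a ∉ cond z → b ∈ cond z := by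
    intro a b hab ha
    have hle : cond z ≤ cond (aeval θ a * z) := fun Q hQ => by
      rw [hcond] at hQ ⊢
      rw [mul_left_comm]
      exact mul_mem (hadj a) hQ
    have hnot := hmax (cond (aeval θ a * z)) ⟨_, (hint a).mul hz, by
      rw [mul_left_comm]
      exact mul_mem (hadj a) hpz, ha, rfl⟩
    have heq : cond z = cond (aeval θ a * z) := by
      by_contra hne
      exact hnot (lt_of_le_of_ne hle hne)
    rw [heq, hcond, ← mul_assoc, mul_comm (aeval θ b), ← map_mul]
    exact hab
  obtain ⟨Φ, hΦ⟩ := IsPrincipalIdealRing.principal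
    ((cond z).map (mapRingHom (Int.castRingHom (ZMod p))))
  have hsurj : Function.Surjective (mapRingHom (Int.castRingHom (ZMod p))) := exists_map_eq p
  obtain ⟨φ, hφM, hφ⟩ := (Ideal.mem_map_iff_of_surjective _ hsurj).1
    (show Φ ∈ (cond z).map (mapRingHom (Int.castRingHom (ZMod p))) by
      rw [hΦ]; exact Submodule.mem_span_singleton_self Φ)
  rw [coe_mapRingHom] at hφ
  have hdecomp : ∀ Q : ℤ[X], Φ ∣ Q.map (Int.castRingHom (ZMod p)) →
      ∃ a b, Q = C (p : ℤ) * a + φ * b := by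
    rintro Q ⟨R, hR⟩
    obtain ⟨b, rfl⟩ := exists_map_eq p R
    rw [← hφ, ← Polynomial.map_mul, ← sub_eq_zero, ← Polynomial.map_sub] at hR
    obtain ⟨a, ha⟩ := C_dvd_of_map_eq_zero hR
    exact ⟨a, b, by linear_combination ha⟩
  have hM : ∀ Q ∈ cond z, ∃ a b, Q = C (p : ℤ) * a + φ * b := fun Q hQ => by
    refine hdecomp Q (Ideal.mem_span_singleton.1 ?_)
    have := Ideal.mem_map_of_mem (mapRingHom (Int.castRingHom (ZMod p))) hQ
    rw [hΦ] at this
    exact this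
  obtain ⟨β, hβ⟩ : ∃ β : F, aeval β Φ = 0 := by
    by_cases h0 : Φ = 0
    · exact ⟨0, by simp [h0]⟩
    refine IsAlgClosed.exists_aeval_eq_zero _ _ fun hd => hone ?_
    have hu : IsUnit Φ := isUnit_iff_degree_eq_zero.2 hd
    obtain ⟨a, b, hab⟩ := hdecomp 1 (hu.dvd)
    rw [hab]
    exact add_mem (Ideal.mul_mem_right _ _ hpM) (Ideal.mul_mem_right _ _ hφM)
  have hle : cond z ≤ vanishingIdealAt β := fun Q hQ => by
    obtain ⟨a, b, rfl⟩ := hM Q hQ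
    have : aeval β φ = 0 := by rw [← aeval_map_zmod (p := p), hφ, hβ]
    simp [mem_vanishingIdealAt, this, natCast_eq_zero_of_algebra (p := p) (F := F)]
  obtain ⟨a, b, hab⟩ := hM T (hzero T hT)
  have hrel : (p : K) * aeval θ a + aeval θ φ * aeval θ b = 0 := by
    rw [hab] at hT
    simpa using hT
  -- After inverting `s`, the prime `cond z` becomes principal in `ℤ[θ]`, generated by `π`. The
  -- relation `p a + φ b = 0` at `θ` allows `π = p` if `b ∉ cond z` and `π = φ` if `a ∉ cond z`;
  -- were both in, `T` would lie in the square.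
  obtain ⟨s, π, hs, hπ, hπ0, hdiv⟩ : ∃ s π : ℤ[X], s ∉ cond z ∧ π ∈ cond z ∧ aeval θ π ≠ 0 ∧
      ∀ Q ∈ cond z, ∃ v, aeval θ s * aeval θ Q = aeval θ π * aeval θ v := by
    by_cases ha : a ∈ cond z
    · have hb : b ∉ cond z := fun hb => hreg β (Ideal.pow_right_mono hle 2 (by
        rw [hab, pow_two]
        exact add_mem (Ideal.mul_mem_mul hpM ha) (Ideal.mul_mem_mul hφM hb)))
      refine ⟨b, C (p : ℤ), hb, hpM, by rwa [hC], fun Q hQ => ?_⟩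
      obtain ⟨a', b', rfl⟩ := hM Q hQ
      refine ⟨b * a' - a * b', ?_⟩
      simp only [map_add, map_mul, map_sub, hC]
      linear_combination aeval θ b' * hrel
    · refine ⟨a, φ, ha, hφM, fun h0 => ha (hzero a ?_), fun Q hQ => ?_⟩
      · rw [h0, zero_mul, add_zero] at hrel
        exact (mul_eq_zero.1 hrel).resolve_left hp0
      · obtain ⟨a', b', rfl⟩ := hM Q hQ
        refine ⟨a * b' - b * a', ?_⟩
        simp only [map_add, map_mul, map_sub, hC]
        linear_combination aeval θ a' * hrel
  -- Thus `z = u(θ) / π(θ)` with `u` outside the prime. Clearing denominators in an integral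
  -- equation for `z` forces a power of `u` into it.
  obtain ⟨u, hu⟩ := mem_adjoin_iff_exists_aeval.1 ((hcond z π).1 hπ)
  have huM : u ∉ cond z := fun huM => hs (by
    obtain ⟨v, hv⟩ := hdiv u huM
    rw [hcond, mul_left_cancel₀ hπ0 (show aeval θ π * (aeval θ s * z) = aeval θ π * aeval θ v by
      rw [← hv, hu]; ring)]
    exact hadj v)
  have hpow : ∀ n : ℕ, u ^ n ∉ cond z := fun n => by
    induction n with
    | zero => simpa using hone
    | succ n ih => exact fun h => huM (hprime _ _ (pow_succ u n ▸ h) ih)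
  obtain ⟨q, hq, hqz⟩ := hz
  set N := q.natDegree
  refine hpow N ?_
  have hsum : u ^ N + ∑ i ∈ Finset.range N, C (q.coeff i) * u ^ i * π ^ (N - i) ∈ cond z := by
    apply hzero
    have h1 : aeval z q = 0 := hqz
    rw [hq.as_sum] at h1
    simp only [map_add, map_pow, aeval_X, map_sum, map_mul, aeval_C] at h1 ⊢
    rw [hu, ← mul_zero (aeval θ π ^ N), ← h1, mul_add, mul_pow, Finset.mul_sum]
    congr 1
    refine Finset.sum_congr rfl fun i hi => ?_
    rw [mul_pow, ← pow_sub_mul_pow (aeval θ π) (Finset.mem_range.1 hi).le]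
    ring
  refine (Submodule.add_mem_iff_left _ (Submodule.sum_mem _ fun i hi => ?_)).1 hsum
  refine Ideal.mul_mem_left _ _ (Ideal.pow_mem_of_mem _ hπ _ ?_)
  have := Finset.mem_range.1 hi
  omega

theorem exists_natCast_mul_mem_adjoin [CharZero K] (hθ : IsIntegral ℤ θ)
    (hK : IntermediateField.adjoin ℚ {θ} = ⊤) (y : K) :
    ∃ N : ℕ, N ≠ 0 ∧ (N : K) * y ∈ Algebra.adjoin ℤ {θ} := by
  have hy : y ∈ IntermediateField.adjoin ℚ {θ} := by simp [hK]
  have hθ' : IsIntegral ℚ θ := hθ.tower_top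
  rw [← IntermediateField.mem_toSubalgebra,
    IntermediateField.adjoin_simple_toSubalgebra_of_isAlgebraic hθ'.isAlgebraic,
    Algebra.adjoin_singleton_eq_range_aeval] at hy
  obtain ⟨P, rfl⟩ := hy
  have hint : ∀ i : ℤ, (i : K) ∈ Algebra.adjoin ℤ {θ} := fun i => by
    simp
  change ∃ N : ℕ, N ≠ 0 ∧ (N : K) * aeval θ P ∈ Algebra.adjoin ℤ {θ}
  induction P using Polynomial.induction_on' with
  | add P Q hP hQ =>
    obtain ⟨M, hM, hMP⟩ := hP
    obtain ⟨N, hN, hNQ⟩ := hQ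
    refine ⟨M * N, mul_ne_zero hM hN, ?_⟩
    rw [map_add, Nat.cast_mul, show (M : K) * N * (aeval θ P + aeval θ Q)
      = (N : ℤ) * (M * aeval θ P) + (M : ℤ) * (N * aeval θ Q) by push_cast; ring]
    exact add_mem (mul_mem (hint _) hMP) (mul_mem (hint _) hNQ)
  | monomial n r =>
    refine ⟨r.den, r.den_ne_zero, ?_⟩
    have hr : (r.den : K) * (r : K) = (r.num : K) := by
      exact_mod_cast congrArg (Rat.cast : ℚ → K) (Rat.den_mul_eq_num r)
    rw [aeval_monomial, ← mul_assoc, eq_ratCast, hr]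
    exact mul_mem (hint _) (pow_mem (Algebra.self_mem_adjoin_singleton ℤ θ) n)

theorem eq_integralClosure_of_regular [CharZero K] (hθ : IsIntegral ℤ θ)
    (hK : IntermediateField.adjoin ℚ {θ} = ⊤)
    (hmax : ∀ p : ℕ, p.Prime → ∀ y : K, IsIntegral ℤ y →
      (p : K) * y ∈ Algebra.adjoin ℤ {θ} → y ∈ Algebra.adjoin ℤ {θ}) :
    Algebra.adjoin ℤ {θ} = integralClosure ℤ K := by
  refine le_antisymm (adjoin_le_integralClosure hθ) fun y hy => ?_
  obtain ⟨N, hN, hNy⟩ := exists_natCast_mul_mem_adjoin hθ hK y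
  replace hy : IsIntegral ℤ y := hy
  induction N using Nat.recOnMul generalizing y with
  | zero => exact absurd rfl hN
  | one => simpa using hNy
  | prime p hp => exact hmax p hp y hy hNy
  | mul a b iha ihb =>
    obtain ⟨ha, hb⟩ := mul_ne_zero_iff.1 hN
    have hby : IsIntegral ℤ ((b : K) * y) := by
      simpa using (isIntegral_algebraMap (R := ℤ) (A := K) (x := b)).mul hy
    refine ihb y hb ?_ hy
    refine iha _ ha ?_ hby
    rwa [← mul_assoc, ← Nat.cast_mul]

theorem dvd_integralIndex_iff [NumberField K] (hθ : IsIntegral ℤ θ)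
    (hK : IntermediateField.adjoin ℚ {θ} = ⊤) (p : ℕ) [Fact p.Prime] :
    p ∣ integralIndex K θ ↔ ∃ y : K, IsIntegral ℤ y ∧ (p : K) * y ∈ Algebra.adjoin ℤ {θ} ∧
      y ∉ Algebra.adjoin ℤ {θ} := by
  set O := (Subalgebra.toSubmodule (integralClosure ℤ K)).toAddSubgroup with hO
  set A := (Subalgebra.toSubmodule (Algebra.adjoin ℤ {θ})).toAddSubgroup with hA
  have hmemO : ∀ y, y ∈ O ↔ IsIntegral ℤ y := fun _ => Iff.rfl
  have hmemA : ∀ y, y ∈ A ↔ y ∈ Algebra.adjoin ℤ {θ} := fun _ => Iff.rfl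
  have hidx : integralIndex K θ = Nat.card (O ⧸ A.addSubgroupOf O) := rfl
  have hmk : ∀ y : O, (QuotientAddGroup.mk y : O ⧸ A.addSubgroupOf O) = 0 ↔
      (y : K) ∈ Algebra.adjoin ℤ {θ} := fun y => by
    rw [QuotientAddGroup.eq_zero_iff, AddSubgroup.mem_addSubgroupOf, hmemA]
  have hnsmul : ∀ (N : ℕ) (y : O), N • (QuotientAddGroup.mk y : O ⧸ A.addSubgroupOf O) = 0 ↔
      (N : K) * y ∈ Algebra.adjoin ℤ {θ} := fun N y => by
    rw [← QuotientAddGroup.mk_nsmul, hmk, AddSubgroup.coe_nsmul, nsmul_eq_mul]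
  rw [hidx]
  constructor
  -- Finiteness of the quotient is needed before Cauchy's theorem, since an infinite index has the
  -- value `0`, divisible by every `p`.
  · intro hdvd
    have : Finite (O ⧸ A.addSubgroupOf O) := by
      have hfin : Module.Finite ℤ O :=
        inferInstanceAs (Module.Finite ℤ (NumberField.RingOfIntegers K))
      have hfg : AddGroup.FG O := Module.Finite.iff_addGroup_fg.1 hfin
      have := QuotientAddGroup.fg (A.addSubgroupOf O)
      refine AddCommGroup.finite_of_fg_isAddTorsion _ fun x => ?_
      obtain ⟨y, rfl⟩ := QuotientAddGroup.mk_surjective x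
      obtain ⟨N, hN, hNy⟩ := exists_natCast_mul_mem_adjoin hθ hK (y : K)
      exact isOfFinAddOrder_iff_nsmul_eq_zero.2 ⟨N, Nat.pos_of_ne_zero hN, (hnsmul N y).2 hNy⟩
    obtain ⟨x, hx⟩ := exists_prime_addOrderOf_dvd_card' p hdvd
    obtain ⟨y, rfl⟩ := QuotientAddGroup.mk_surjective x
    refine ⟨y, (hmemO _).1 y.2, (hnsmul p y).1 (hx ▸ addOrderOf_nsmul_eq_zero _), fun h => ?_⟩
    rw [(hmk y).2 h, addOrderOf_zero] at hx
    exact (Fact.out : p.Prime).ne_one hx.symm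
  · rintro ⟨y, hy, hpy, hyn⟩
    have h1 := addOrderOf_eq_prime ((hnsmul p ⟨y, hy⟩).2 hpy) (fun h => hyn ((hmk ⟨y, hy⟩).1 h))
    rw [← h1]
    exact addOrderOf_dvd_natCard _

end IntegralClosure

/-! ### Simple and multiple roots of `(x ^ k + c) ^ m - a x ^ n` mod `p`. -/

section Family

variable {a c : ℤ} {k m n : ℕ}

theorem natDegree_base_pow_and_monic (hkm : 0 < k * m) :
    ((X ^ k + C c : ℤ[X]) ^ m).natDegree = k * m ∧ ((X ^ k + C c : ℤ[X]) ^ m).Monic := by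
  have hk : k ≠ 0 := (Nat.pos_of_mul_pos_right hkm).ne'
  have h := monic_X_pow_add_C c hk
  refine ⟨?_, h.pow m⟩
  rw [h.natDegree_pow, natDegree_X_pow_add_C, mul_comm]

theorem degree_C_mul_X_pow_lt_base_pow (hkmn : n < k * m) :
    (C a * X ^ n : ℤ[X]).degree < ((X ^ k + C c : ℤ[X]) ^ m).degree := by
  obtain ⟨h1, h2⟩ := natDegree_base_pow_and_monic (c := c) (Nat.zero_lt_of_lt hkmn)
  rw [degree_eq_natDegree h2.ne_zero, h1]
  exact (degree_C_mul_X_pow_le n a).trans_lt (by exact_mod_cast hkmn)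

theorem familyPoly_monic (hkmn : n < k * m) : (familyPoly a c k m n).Monic :=
  (natDegree_base_pow_and_monic (Nat.zero_lt_of_lt hkmn)).2.sub_of_left
    (degree_C_mul_X_pow_lt_base_pow hkmn)

theorem natDegree_familyPoly (hkmn : n < k * m) : (familyPoly a c k m n).natDegree = k * m := by
  rw [familyPoly, natDegree_sub_eq_left_of_natDegree_lt,
    (natDegree_base_pow_and_monic (Nat.zero_lt_of_lt hkmn)).1]
  rw [(natDegree_base_pow_and_monic (Nat.zero_lt_of_lt hkmn)).1]
  exact (natDegree_C_mul_X_pow_le a n).trans_lt hkmn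

variable {F : Type*} [Field F]

theorem aeval_familyPoly (α : F) :
    aeval α (familyPoly a c k m n) = (α ^ k + c) ^ m - a * α ^ n := by
  simp [familyPoly]

theorem aeval_derivative_familyPoly (α : F) :
    aeval α (derivative (familyPoly a c k m n)) =
      m * (α ^ k + c) ^ (m - 1) * (k * α ^ (k - 1)) - a * (n * α ^ (n - 1)) := by
  simp [familyPoly, derivative_pow]

theorem familyPoly_mem_vanishingIdealAt_zero_sq (hc : (c : F) = 0) (hk : k ≠ 0) (hm : 2 ≤ m)
    (hn : 2 ≤ n) : familyPoly a c k m n ∈ vanishingIdealAt (0 : F) ^ 2 := by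
  have hX : (X : ℤ[X]) ∈ vanishingIdealAt (0 : F) := by simp [mem_vanishingIdealAt]
  refine sub_mem (Ideal.pow_le_pow_right hm (Ideal.pow_mem_pow ?_ m))
    (Ideal.mul_mem_left _ _ (Ideal.pow_le_pow_right hn (Ideal.pow_mem_pow hX n)))
  simp [mem_vanishingIdealAt, hk, hc]

/-- With `c = 0` the polynomial is `x ^ (k m) - a x ^ n`; apply `x d/dx` and eliminate `a x ^ n`. -/
theorem mul_aeval_derivative_familyPoly (hk : k ≠ 0) (hm : m ≠ 0) (hn : n ≠ 0) (hc : (c : F) = 0)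
    {x : F} (hx : aeval x (familyPoly a c k m n) = 0) :
    x * aeval x (derivative (familyPoly a c k m n)) = ((k : F) * m - n) * x ^ (k * m) := by
  obtain ⟨k, rfl⟩ := Nat.exists_eq_succ_of_ne_zero hk
  obtain ⟨m, rfl⟩ := Nat.exists_eq_succ_of_ne_zero hm
  obtain ⟨n, rfl⟩ := Nat.exists_eq_succ_of_ne_zero hn
  rw [aeval_familyPoly, hc, add_zero, ← pow_mul] at hx
  rw [aeval_derivative_familyPoly, hc, add_zero, ← pow_mul]
  simp only [Nat.succ_eq_add_one, Nat.add_sub_cancel] at hx ⊢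
  push_cast
  linear_combination ((n : F) + 1) * hx

theorem aeval_zero_derivative_familyPoly (hn : n ≠ 0) (hkmn : n < k * m) (hc : (c : F) = 0) :
    aeval (0 : F) (derivative (familyPoly a c k m n)) = if n = 1 then -(a : F) else 0 := by
  have hk : k ≠ 0 := by rintro rfl; simp at hkmn
  have hlead : ((0 : F) ^ k + c) ^ (m - 1) * (0 : F) ^ (k - 1) = 0 := by
    rw [hc, zero_pow hk, add_zero, ← pow_add]
    apply zero_pow
    intro h
    have h1 : m ≤ 1 := by omega
    have h2 : k ≤ 1 := by omega
    have := Nat.mul_le_mul h2 h1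
    omega
  rw [aeval_derivative_familyPoly, show (m : F) * ((0 : F) ^ k + c) ^ (m - 1) *
    (k * (0 : F) ^ (k - 1)) = m * k * (((0 : F) ^ k + c) ^ (m - 1) * (0 : F) ^ (k - 1)) by ring,
    hlead]
  split_ifs with h
  · simp [h]
  · rw [zero_pow (show n - 1 ≠ 0 by omega)]
    simp

variable {p : ℕ} [CharP F p]

/-- Away from the exceptional primes, a prime dividing the discriminant admits a simple root of the
reduction only at the origin, and only for `n = 1`. -/
theorem simple_root_of_notMem_exceptionalPrimes [IsAlgClosed F] (hp : p.Prime) (hn : 1 ≤ n)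
    (hkmn : n < k * m) (hk : ((UniqueFactorizationMonoid.radical k : ℕ) : ℤ) ∣ c * a)
    (hD : (p : ℤ) ∣ (familyPoly a c k m n).discr) (hpE : p ∉ exceptionalPrimes a c k m n)
    (hreg : familyPoly a c k m n ∉ vanishingIdealAt (0 : F) ^ 2) {α : F}
    (h0 : aeval α (familyPoly a c k m n) = 0)
    (h1 : aeval α (derivative (familyPoly a c k m n)) ≠ 0) :
    n = 1 ∧ (c : F) = 0 ∧ (a : F) ≠ 0 ∧ α = 0 := by
  have hk0 : k ≠ 0 := by rintro rfl; simp at hkmn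
  have hm0 : m ≠ 0 := by rintro rfl; simp at hkmn
  have hn0 : n ≠ 0 := by omega
  have hcast : ∀ x : ℤ, (p : ℤ) ∣ x ↔ (x : F) = 0 := fun x => (CharP.intCast_eq_zero_iff F p x).symm
  obtain ⟨γ, hγ0, hγ1⟩ := (intCast_discr_eq_zero_iff (F := F)
    (by rw [familyPoly_monic hkmn]; exact isUnit_one)
    (by rw [natDegree_familyPoly hkmn]; omega)).1 ((hcast _).1 hD)
  simp only [exceptionalPrimes, Set.mem_union, Set.mem_ofPred_eq, not_or, not_and, not_not,
    hp, hD, forall_const] at hpE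
  obtain ⟨hE1, hE2⟩ := hpE
  simp only [hcast] at hE1 hE2
  push_cast at hE1 hE2
  by_cases ha : (a : F) = 0
  -- A simple root of `(x ^ k + c) ^ m` forces `m = 1` and `p ∤ k`; the multiple root `γ` is then
  -- `0`, so `c = 0` and `α = 0`, which is not simple because `k > 1`.
  · exfalso
    rw [aeval_familyPoly, ha, zero_mul, sub_zero] at h0 hγ0
    rw [aeval_derivative_familyPoly, ha, zero_mul, sub_zero] at h1 hγ1
    have hα := pow_eq_zero_iff hm0 |>.1 h0
    have hγ := pow_eq_zero_iff hm0 |>.1 hγ0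
    have hm1 : m = 1 := by
      by_contra hm
      rw [hα, zero_pow (show m - 1 ≠ 0 by omega)] at h1
      simp at h1
    subst hm1
    have hk1 : k - 1 ≠ 0 := by omega
    simp only [Nat.sub_self, pow_zero, Nat.cast_one, one_mul, mul_one, ne_eq, mul_eq_zero,
      not_or, pow_eq_zero_iff hk1] at h1 hγ1
    have hγ00 := hγ1.resolve_left h1.1
    rw [hγ00, zero_pow hk0, zero_add] at hγ
    rw [hγ, add_zero, pow_eq_zero_iff hk0] at hα
    exact h1.2 hα
  by_cases hc : (c : F) = 0
  · have hα := mul_aeval_derivative_familyPoly hk0 hm0 hn0 hc h0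
    have hγ := mul_aeval_derivative_familyPoly hk0 hm0 hn0 hc hγ0
    have hz := aeval_zero_derivative_familyPoly (a := a) hn0 hkmn hc
    have hzero : (k : F) * m - n = 0 → α = 0 := fun h => by
      rw [h, zero_mul] at hα
      exact (mul_eq_zero.1 hα).resolve_right h1
    by_cases hn1 : n = 1
    · refine ⟨hn1, hc, ha, hzero ?_⟩
      -- The origin is simple when `n = 1`, so the multiple root lies elsewhere and forces `k m = n`
      -- in `F`.
      have hγne : γ ≠ 0 := by
        rintro rfl
        rw [hγ1, if_pos hn1] at hz
        exact ha (neg_eq_zero.1 hz.symm)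
      rw [hγ1, mul_zero] at hγ
      exact (mul_eq_zero.1 hγ.symm).resolve_right (pow_ne_zero _ hγne)
    · exfalso
      by_cases hm : m = 1
      · have h2 := (mul_eq_zero.1 (hE2 hm hc)).resolve_left ha
        have h3 := hzero (by simpa [hm] using h2)
        rw [h3, hz, if_neg hn1] at h1
        exact h1 rfl
      · exact hreg (familyPoly_mem_vanishingIdealAt_zero_sq hc hk0 (by omega) (by omega))
  · exfalso
    -- The radical condition excludes `p ∣ k`, so `p ∣ m`; the multiple root `γ ≠ 0` then gives `p ∣
    -- n`, and `f'` vanishes identically.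
    have hkF : (k : F) ≠ 0 := fun h => by
      have hpk : p ∣ k := (CharP.cast_eq_zero_iff F p k).1 h
      have hpr : p ∣ UniqueFactorizationMonoid.radical k :=
        (UniqueFactorizationMonoid.dvd_radical_iff_of_irreducible hp hk0).2 hpk
      have := (hcast _).1 ((Int.natCast_dvd_natCast.2 hpr).trans hk)
      push_cast at this
      exact (mul_ne_zero hc ha) this
    have hmF : (m : F) = 0 := by simpa [ha, hc, hkF] using hE1
    rw [aeval_derivative_familyPoly, hmF, zero_mul, zero_mul, zero_sub] at h1 hγ1
    have hγne : γ ≠ 0 := by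
      rintro rfl
      rw [aeval_familyPoly, zero_pow hk0, zero_pow hn0] at hγ0
      simp [hc, hm0] at hγ0
    have hnF : (n : F) = 0 := by simpa [ha, hγne] using hγ1
    rw [hnF] at h1
    simp at h1

/-- If `g` vanishes at the origin modulo `p` and its derivative is a nonzero monomial there, then a
critical point of `g` lies over a simple root only at the origin, and only for `n = 1`. -/
theorem simple_root_of_derivative_eq_C_mul_X_pow [Fact p.Prime] [Algebra (ZMod p) F] (hn : n ≠ 0)
    (hkmn : n < k * m) {g : ℤ[X]} {d : ℕ} (hg0 : (p : ℤ) ∣ g.eval 0) (hpd : ¬ p ∣ d)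
    (hder : (derivative g).map (Int.castRingHom (ZMod p)) = C (d : ZMod p) * X ^ (d - 1)) {β : F}
    (h0 : aeval (aeval β g) (familyPoly a c k m n) = 0)
    (h1 : aeval (aeval β g) (derivative (familyPoly a c k m n)) ≠ 0)
    (hg' : aeval β (derivative g) = 0) :
    n = 1 ∧ (c : F) = 0 ∧ (a : F) ≠ 0 ∧ aeval β g = 0 := by
  have hk0 : k ≠ 0 := by rintro rfl; simp at hkmn
  have hdF : (d : F) ≠ 0 := fun h => hpd ((CharP.cast_eq_zero_iff F p d).1 h)
  rw [← aeval_map_zmod (p := p), hder] at hg'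
  have hβ0 : β = 0 := by
    have h3 : β ^ (d - 1) = 0 := by simpa [hdF] using hg'
    exact eq_zero_of_pow_eq_zero h3
  have hα : aeval β g = 0 := by
    rw [hβ0, ← coeff_zero_eq_aeval_zero', coeff_zero_eq_eval_zero, eq_intCast]
    exact (CharP.intCast_eq_zero_iff F p _).2 hg0
  rw [hα] at h0 h1
  have hc : (c : F) = 0 := by
    rw [aeval_familyPoly, zero_pow hk0, zero_pow hn] at h0
    have h3 : (c : F) ^ m = 0 := by simpa using h0
    exact eq_zero_of_pow_eq_zero h3
  rw [aeval_zero_derivative_familyPoly hn hkmn hc] at h1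
  split_ifs at h1 with hn'
  · exact ⟨hn', hc, neg_ne_zero.1 h1, hα⟩
  · exact absurd rfl h1

end Family

/-! ### Monogenicity as regularity, and the equivalence. -/

theorem aeval_root_map_rat (f : ℤ[X]) [Fact (Irreducible (f.map (Int.castRingHom ℚ)))] :
    aeval (AdjoinRoot.root (f.map (Int.castRingHom ℚ))) f = 0 := by
  rw [← aeval_map_algebraMap ℚ, algebraMap_int_eq]
  exact (AdjoinRoot.aeval_eq _).trans AdjoinRoot.mk_self

/-- A monic polynomial generating a monogenic order is regular at every closed point. -/
theorem IsMonogenicPoly.notMem_vanishingIdealAt_sq {f : ℤ[X]} (hf : IsMonogenicPoly f)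
    {F : Type*} [Field F] (p : ℕ) [Fact p.Prime] [Algebra (ZMod p) F]
    [Algebra.IsAlgebraic (ZMod p) F] (α : F) : f ∉ vanishingIdealAt α ^ 2 := by
  obtain ⟨hmonic, hirr, hadj⟩ := hf
  have : Fact (Irreducible (f.map (Int.castRingHom ℚ))) := ⟨hirr⟩
  intro hα
  have hroot := aeval_root_map_rat f
  obtain ⟨y, hy, -, hyn⟩ := exists_integral_notMem_adjoin_of_mem_sq
    (by rw [hmonic]; exact isUnit_one) hirr hroot p hα
  exact hyn (hadj ▸ hy)

theorem isMonogenicPoly_of_forall_notMem_sq {f : ℤ[X]} (hmonic : f.Monic)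
    (hirr : Irreducible (f.map (Int.castRingHom ℚ)))
    (hreg : ∀ p : ℕ, ∀ _ : Fact p.Prime, ∀ α : AlgebraicClosure (ZMod p),
      f ∉ vanishingIdealAt α ^ 2) : IsMonogenicPoly f := by
  refine ⟨hmonic, hirr, ?_⟩
  have : Fact (Irreducible (f.map (Int.castRingHom ℚ))) := ⟨hirr⟩
  have hroot := aeval_root_map_rat f
  have hint := isIntegral_of_isUnit_leadingCoeff (by rw [hmonic]; exact isUnit_one) hroot
  refine eq_integralClosure_of_regular hint (IntermediateField.adjoin_root_eq_top _) ?_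
  intro p hp y hy hpy
  have := Fact.mk hp
  exact mem_adjoin_of_natCast_mul_mem hint hroot (AlgebraicClosure (ZMod p)) p
    (by exact_mod_cast hp.ne_zero) (hreg p this) hy hpy

theorem natDegree_pos_of_irreducible_map_comp {f g : ℤ[X]}
    (h : Irreducible ((f.comp g).map (Int.castRingHom ℚ))) : 0 < g.natDegree := by
  rw [Nat.pos_iff_ne_zero]
  intro hg
  rw [eq_C_of_natDegree_eq_zero hg, comp_C, map_C] at h
  exact h.not_isUnit (isUnit_C.2 (isUnit_iff_ne_zero.2 (fun h0 => h.ne_zero (by rw [h0, C_0]))))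

theorem exists_aeval_eq_of_isUnit_leadingCoeff {F : Type*} [Field F] [IsAlgClosed F] {g : ℤ[X]}
    (hg : IsUnit g.leadingCoeff) (hdeg : 0 < g.natDegree) (α : F) : ∃ β : F, aeval β g = α := by
  have hu : (Int.castRingHom F) g.leadingCoeff ≠ 0 := (hg.map _).ne_zero
  have hnd : (g.map (Int.castRingHom F)).natDegree = g.natDegree :=
    natDegree_map_of_leadingCoeff_ne_zero _ hu
  obtain ⟨β, hβ⟩ := IsAlgClosed.exists_root (g.map (Int.castRingHom F) - C α) (by
    intro h
    have h2 := natDegree_eq_zero_iff_degree_le_zero.2 h.le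
    rw [natDegree_sub_C, hnd] at h2
    omega)
  refine ⟨β, ?_⟩
  rw [IsRoot.def, eval_sub, eval_C, sub_eq_zero, eval_map] at hβ
  exact hβ

theorem theorem2p7 (a c : ℤ) (k m n : ℕ) (hn : 1 ≤ n) (hkmn : n < k * m)
    (hf : Irreducible ((familyPoly a c k m n).map (Int.castRingHom ℚ)))
    (g : ℤ[X]) (d : ℕ) (hd : g.natDegree = d)
    (hg : g.leadingCoeff = 1 ∨ g.leadingCoeff = -1)
    (hT : Irreducible (((familyPoly a c k m n).comp g).map (Int.castRingHom ℚ)))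
    (K : Type*) [Field K] [NumberField K] (θ : K)
    (hθ : aeval θ ((familyPoly a c k m n).comp g) = 0)
    (hK : IntermediateField.adjoin ℚ {θ} = ⊤)
    (hk : ((UniqueFactorizationMonoid.radical k : ℕ) : ℤ) ∣ c * a)
    (hE : ∀ p ∈ exceptionalPrimes a c k m n,
      (p : ℤ) ∣ g.eval 0 ∧ ¬ p ∣ d ∧
        (derivative g).map (Int.castRingHom (ZMod p)) = C (d : ZMod p) * X ^ (d - 1))
    (hn1 : n = 1 → ∀ p : ℕ, p.Prime → (p : ℤ) ∣ (familyPoly a c k m n).discr →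
      (p : ℤ) ∣ c → ¬ (p : ℤ) ∣ a → ¬ (p : ℤ) ∣ g.discr) :
    (∀ p : ℕ, p.Prime → (p : ℤ) ∣ (familyPoly a c k m n).discr → ¬ p ∣ integralIndex K θ) ↔
      IsMonogenicPoly (familyPoly a c k m n) := by
  have hgu : IsUnit g.leadingCoeff := Int.isUnit_iff.2 hg
  have hdpos : 0 < g.natDegree := natDegree_pos_of_irreducible_map_comp hT
  have hmonic : (familyPoly a c k m n).Monic := familyPoly_monic hkmn
  have hfu : IsUnit (familyPoly a c k m n).leadingCoeff := by rw [hmonic]; exact isUnit_one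
  have hfdeg : 0 < (familyPoly a c k m n).natDegree := by rw [natDegree_familyPoly hkmn]; omega
  have hk0 : k ≠ 0 := by rintro rfl; simp at hkmn
  have hTu : IsUnit ((familyPoly a c k m n).comp g).leadingCoeff := by
    rw [leadingCoeff_comp hdpos.ne', hmonic, one_mul]
    exact hgu.pow _
  have hint : IsIntegral ℤ θ := isIntegral_of_isUnit_leadingCoeff hTu hθ
  constructor
  · intro h
    refine isMonogenicPoly_of_forall_notMem_sq hmonic hf fun p hp α hα => ?_
    have h0 : aeval α (familyPoly a c k m n) = 0 :=
      mem_vanishingIdealAt.1 (Ideal.pow_le_self two_ne_zero hα)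
    have h1 := aeval_derivative_eq_zero_of_mem_sq p hα
    have hD : (p : ℤ) ∣ (familyPoly a c k m n).discr :=
      (CharP.intCast_eq_zero_iff (AlgebraicClosure (ZMod p)) p _).1
        ((intCast_discr_eq_zero_iff hfu hfdeg).2 ⟨α, h0, h1⟩)
    obtain ⟨β, rfl⟩ := exists_aeval_eq_of_isUnit_leadingCoeff hgu hdpos α
    exact h p hp.out hD ((dvd_integralIndex_iff hint hK p).2
      (exists_integral_notMem_adjoin_of_mem_sq hTu hT hθ p (comp_mem_vanishingIdealAt_sq g hα)))
  · intro hmono p hp hD hidx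
    have := Fact.mk hp
    obtain ⟨y, hy, hpy, hyn⟩ := (dvd_integralIndex_iff hint hK p).1 hidx
    refine hyn (mem_adjoin_of_natCast_mul_mem hint hθ (AlgebraicClosure (ZMod p)) p
      (by exact_mod_cast hp.ne_zero) (fun β hβ => ?_) hy hpy)
    have hcast : ∀ x : ℤ, (p : ℤ) ∣ x ↔ (x : AlgebraicClosure (ZMod p)) = 0 := fun x =>
      (CharP.intCast_eq_zero_iff (AlgebraicClosure (ZMod p)) p x).symm
    have h0 : aeval (aeval β g) (familyPoly a c k m n) = 0 := by
      rw [← aeval_comp]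
      exact mem_vanishingIdealAt.1 (Ideal.pow_le_self two_ne_zero hβ)
    by_cases h1 : aeval (aeval β g) (derivative (familyPoly a c k m n)) = 0
    · exact comp_notMem_sq p h0 h1 (hmono.notMem_vanishingIdealAt_sq p _) hβ
    have hg' : aeval β (derivative g) = 0 := by
      have h2 := aeval_derivative_eq_zero_of_mem_sq p hβ
      rw [derivative_comp, map_mul, aeval_comp] at h2
      exact (mul_eq_zero.1 h2).resolve_right h1
    obtain ⟨hn1', hc, ha, hα⟩ : n = 1 ∧ (c : AlgebraicClosure (ZMod p)) = 0 ∧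
        (a : AlgebraicClosure (ZMod p)) ≠ 0 ∧ aeval β g = 0 := by
      by_cases hpE : p ∈ exceptionalPrimes a c k m n
      · obtain ⟨hg0, hpd, hder⟩ := hE p hpE
        exact simple_root_of_derivative_eq_C_mul_X_pow (by omega) hkmn hg0 hpd hder h0 h1 hg'
      · exact simple_root_of_notMem_exceptionalPrimes hp hn hkmn hk hD hpE
          (hmono.notMem_vanishingIdealAt_sq p _) h0 h1
    exact hn1 hn1' p hp hD ((hcast _).2 hc) (fun h => ha ((hcast _).1 h)) ((hcast _).2
      ((intCast_discr_eq_zero_iff hgu hdpos).2 ⟨β, hα, hg'⟩))
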